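/- Let $k\ge 2$ be an integer. Let $Z_k$ be the infinite graph with vertices $v_{i,j}$ and $w_{i,j}$ ($i\in\mathbb Z$, $1\le j\le k$), in which every $v_{i,j}$ is joined to every $w_{i,l}$ ($i\in\mathbb Z$, $1\le j,l\le k$) and every $w_{i,j}$ is joined to $v_{i+1,j}$ ($i\in\mathbb Z$, $1\le j\le k$), and let $W_{n,k}$ be the finite graph defined in the same way with the index $i$ taken modulo $n$. Then $Z_k$ is an infinite, vertex-transitive, $(k+1)$-regular graph, and it is the local limit of the graphs $W_{n,k}$ as $n\to\infty$: for every $r$ and all sufficiently large $n$, every ball of radius $r$ in $W_{n,k}$ is isomorphic, as a graph rooted at its centre, to every ball of radius $r$ in $Z_k$. Let $A$ be the adjacency operator of $Z_k$, $(Af)(x)=\sum_{y\sim x}f(y)$, a bounded operator on $\ell^2(V(Z_k))$. Then $A$ is self-adjoint, and its spectrum is $$\sigma(Z_k)=\{-1,1\}\cup[k-1,k+1]\cup[-k-1,-k+1].$$ For a vertex $x$, let $\mu_x$ be the spectral measure of $A$ at the unit vector $\delta_x$, that is, the Borel measure on $\mathbb R$ with $\int f\,d\mu_x=\langle\delta_x,f(A)\delta_x\rangle$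 for all continuous compactly supported $f$. Then for every vertex $x$ $$\mu_x\big([k-1,k+1]\setminus\{1\}\big)=\mu_x\big([-k-1,-k+1]\setminus\{-1\}\big)=\frac1{2k},\qquad \mu_x(\{1\})=\mu_x(\{-1\})=\frac12-\frac1{2k}.$$ (Removing the points $\pm1$ from the intervals matters only for $k=2$, when they are end points of the intervals.) -/

import Mathlib

open scoped CompactlySupported ENNReal

noncomputable section

namespace SimpleGraph

/-! ### Vertex-transitivity and local limits -/

/-- Any vertex can be moved to any other by a graph automorphism. -/
def IsVertexTransitive {V : Type*} (G : SimpleGraph V) : Prop :=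
  ∀ u v : V, ∃ φ : G ≃g G, φ u = v

/-- The ball of radius `r` around `x`: all vertices at distance at most `r` from `x`. -/
def closedBall {V : Type*} (G : SimpleGraph V) (x : V) (r : ℕ) : Set V :=
  {y | G.edist x y ≤ r}

theorem self_mem_closedBall {V : Type*} (G : SimpleGraph V) (x : V) (r : ℕ) :
    x ∈ G.closedBall x r := by
  simp [closedBall]

/-- `H` is the local limit of the sequence `G n`: for each radius `r` and all large enough `n`,
each ball of radius `r` in `G n` is isomorphic, as a graph with a distinguished centre, to each
ball of radius `r` in `H`. -/
def IsLocalLimit {V : ℕ → Type*} {U : Type*} (G : ∀ n, SimpleGraph (V n))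
    (H : SimpleGraph U) : Prop :=
  ∀ r : ℕ, ∀ᶠ n in Filter.atTop, ∀ (x : V n) (z : U),
    ∃ φ : (G n).induce ((G n).closedBall x r) ≃g H.induce (H.closedBall z r),
      φ ⟨x, self_mem_closedBall _ x r⟩ = ⟨z, self_mem_closedBall _ z r⟩

/-! ### The adjacency operator of a graph of bounded degree -/

section AdjacencyOperator

variable {V : Type*} (G : SimpleGraph V) [G.LocallyFinite]

theorem sum_norm_sq_neighbor_sum_le (d : ℕ) (hd : ∀ v, G.degree v ≤ d)
    (f : lp (fun _ : V => ℂ) 2) (s : Finset V) :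
    ∑ v ∈ s, ‖∑ u ∈ G.neighborFinset v, f u‖ ^ (2 : ℝ≥0∞).toReal
      ≤ ((d : ℝ) * ‖f‖) ^ (2 : ℝ≥0∞).toReal := by
  classical
  have hf : ∀ T : Finset V, ∑ u ∈ T, ‖f u‖ ^ 2 ≤ ‖f‖ ^ 2 := fun T => by
    simpa using lp.sum_rpow_le_norm_rpow (p := 2) (by norm_num) f T
  simp only [ENNReal.toReal_ofNat, Real.rpow_ofNat]
  calc ∑ v ∈ s, ‖∑ u ∈ G.neighborFinset v, f u‖ ^ 2
      ≤ ∑ v ∈ s, (d : ℝ) * ∑ u ∈ G.neighborFinset v, ‖f u‖ ^ 2 := by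
        refine Finset.sum_le_sum fun v _ => ?_
        calc ‖∑ u ∈ G.neighborFinset v, f u‖ ^ 2
            ≤ (∑ u ∈ G.neighborFinset v, ‖f u‖) ^ 2 := by
              gcongr
              exact norm_sum_le _ _
          _ ≤ ((G.neighborFinset v).card : ℝ) * ∑ u ∈ G.neighborFinset v, ‖f u‖ ^ 2 :=
              sq_sum_le_card_mul_sum_sq
          _ ≤ (d : ℝ) * ∑ u ∈ G.neighborFinset v, ‖f u‖ ^ 2 := by
              gcongr
              exact hd v
    _ = (d : ℝ) * ∑ u ∈ s.biUnion (fun v => G.neighborFinset v),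
          ∑ v ∈ s with u ∈ G.neighborFinset v, ‖f u‖ ^ 2 := by
        rw [← Finset.mul_sum]
        congr 1
        refine Finset.sum_comm' fun v u => ?_
        simp only [Finset.mem_filter, Finset.mem_biUnion]
        exact ⟨fun h => ⟨h, v, h⟩, fun h => h.1⟩
    _ ≤ (d : ℝ) * ∑ u ∈ s.biUnion (fun v => G.neighborFinset v), (d : ℝ) * ‖f u‖ ^ 2 := by
        gcongr with u _
        rw [Finset.sum_const, nsmul_eq_mul]
        gcongr
        refine le_trans (Finset.card_le_card fun v hv => ?_) (hd u)
        simp only [Finset.mem_filter, mem_neighborFinset] at hv ⊢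
        exact hv.2.symm
    _ ≤ (d : ℝ) * ((d : ℝ) * ‖f‖ ^ 2) := by
        rw [← Finset.mul_sum]
        gcongr
        exact hf _
    _ = ((d : ℝ) * ‖f‖) ^ 2 := by ring

/-- The adjacency operator `(A f) v = ∑_{u ~ v} f u` on `ℓ²(V)`, for a graph all of whose degrees
are at most `d`. -/
def adjacencyOperator (d : ℕ) (hd : ∀ v, G.degree v ≤ d) :
    lp (fun _ : V => ℂ) 2 →L[ℂ] lp (fun _ : V => ℂ) 2 :=
  LinearMap.mkContinuous
    { toFun := fun f => ⟨fun v => ∑ u ∈ G.neighborFinset v, f u,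
        memℓp_gen' (sum_norm_sq_neighbor_sum_le G d hd f)⟩
      map_add' := fun f g => by
        ext v
        exact Finset.sum_add_distrib
      map_smul' := fun c f => by
        ext v
        exact (Finset.mul_sum _ _ _).symm }
    d
    (fun f => lp.norm_le_of_forall_sum_le (by norm_num) (by positivity)
      (sum_norm_sq_neighbor_sum_le G d hd f))

theorem adjacencyOperator_apply (d : ℕ) (hd : ∀ v, G.degree v ≤ d)
    (f : lp (fun _ : V => ℂ) 2) (v : V) :
    G.adjacencyOperator d hd f v = ∑ u ∈ G.neighborFinset v, f u := rfl

end AdjacencyOperator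

end SimpleGraph

/-! ### Spectral measures of bounded self-adjoint operators -/

section SpectralMeasure

variable {H : Type*} [NormedAddCommGroup H] [InnerProductSpace ℂ H] [CompleteSpace H]

/-- The positive linear functional `f ↦ ⟨x, f(A) x⟩` on `C_c(ℝ, ℝ)`, where `f(A)` is given by the
continuous functional calculus of the self-adjoint operator `A`. -/
def spectralFunctional (A : H →L[ℂ] H) (x : H) : C_c(ℝ, ℝ) →ₚ[ℝ] ℝ :=
  PositiveLinearMap.mk₀
    { toFun := fun f => (inner ℂ x (cfc (f : ℝ → ℝ) A x)).re
      map_add' := fun f g => by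
        have h := cfc_add (a := A) (f : ℝ → ℝ) (g : ℝ → ℝ)
          f.continuous.continuousOn g.continuous.continuousOn
        have h' : cfc (⇑(f + g)) A = cfc (f : ℝ → ℝ) A + cfc (g : ℝ → ℝ) A := h
        rw [h', add_apply, inner_add_right, Complex.add_re]
      map_smul' := fun c f => by
        have h := cfc_smul c (f : ℝ → ℝ) A f.continuous.continuousOn
        have h' : cfc (⇑(c • f)) A = c • cfc (f : ℝ → ℝ) A := h
        rw [h', smul_apply, inner_smul_right_eq_smul, Complex.smul_re]
        rfl }
    (fun f hf => by
      have h : 0 ≤ cfc (f : ℝ → ℝ) A := cfc_nonneg fun t _ => hf t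
      have h2 := (ContinuousLinearMap.nonneg_iff_isPositive _).1 h
      exact h2.re_inner_nonneg_right x)

/-- The spectral measure of the self-adjoint operator `A` at the vector `x`: the regular Borel
measure `μ` on `ℝ` with `∫ f dμ = ⟨x, f(A) x⟩` for all `f ∈ C_c(ℝ, ℝ)`; equivalently
`μ(B) = ⟨x, E(B) x⟩`, where `E` is the resolution of the identity of `A`. -/
def spectralMeasure (A : H →L[ℂ] H) (x : H) : MeasureTheory.Measure ℝ :=
  RealRMK.rieszMeasure (spectralFunctional A x)

end SpectralMeasure

/-! ### The graphs `W_{n,k}` and `Z_k` -/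

/-- Vertices: `Sum.inl (i, j)` is `v_{i,j}` and `Sum.inr (i, j)` is `w_{i,j}`. -/
abbrev LayerVertex (I : Type) (k : ℕ) : Type := (I × Fin k) ⊕ (I × Fin k)

/-- Layers indexed by `I`: each `v_{i,j}` is joined to each `w_{i,l}`, and each `w_{i,j}` is joined
to `v_{i+1,j}`. -/
def layerGraph (I : Type) [Add I] [One I] (k : ℕ) : SimpleGraph (LayerVertex I k) where
  Adj
    | .inl (i, j), .inr (i', l) => i = i' ∨ (i = i' + 1 ∧ j = l)
    | .inr (i', l), .inl (i, j) => i = i' ∨ (i = i' + 1 ∧ j = l)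
    | _, _ => False
  symm := ⟨by rintro (⟨i, j⟩ | ⟨i, j⟩) (⟨i', l⟩ | ⟨i', l⟩) h <;> exact h⟩
  loopless := ⟨by rintro (⟨i, j⟩ | ⟨i, j⟩) h <;> exact h⟩

/-- The finite graph `W_{n,k}`, with first index modulo `n`. -/
abbrev graphW (n k : ℕ) : SimpleGraph (LayerVertex (ZMod n) k) := layerGraph (ZMod n) k

/-- The infinite graph `Z_k`. -/
abbrev graphZ (k : ℕ) : SimpleGraph (LayerVertex ℤ k) := layerGraph ℤ k

/-- The list of neighbours of a vertex of `Z_k`. -/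
def graphZNeighbors (k : ℕ) : LayerVertex ℤ k → Finset (LayerVertex ℤ k)
  | .inl (i, j) => insert (.inr (i - 1, j)) (Finset.univ.image fun l : Fin k => .inr (i, l))
  | .inr (i, j) => insert (.inl (i + 1, j)) (Finset.univ.image fun l : Fin k => .inl (i, l))

theorem mem_graphZNeighbors (k : ℕ) (x y : LayerVertex ℤ k) :
    y ∈ graphZNeighbors k x ↔ y ∈ (graphZ k).neighborSet x := by
  rcases x with ⟨i, j⟩ | ⟨i, j⟩ <;> rcases y with ⟨i', l⟩ | ⟨i', l⟩ <;>
    simp [graphZNeighbors, layerGraph, SimpleGraph.neighborSet] <;> grind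

instance graphZLocallyFinite (k : ℕ) : (graphZ k).LocallyFinite := fun x =>
  Fintype.ofFinset (graphZNeighbors k x) (mem_graphZNeighbors k x)

theorem graphZ_degree (k : ℕ) (x : LayerVertex ℤ k) : (graphZ k).degree x = k + 1 := by
  have h : (graphZ k).neighborFinset x = graphZNeighbors k x := by
    ext y
    rw [mem_graphZNeighbors, SimpleGraph.mem_neighborFinset, SimpleGraph.mem_neighborSet]
  rw [← SimpleGraph.card_neighborFinset_eq_degree, h]
  rcases x with ⟨i, j⟩ | ⟨i, j⟩ <;> simp only [graphZNeighbors]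
  · rw [Finset.card_insert_of_notMem (by simp; omega),
      Finset.card_image_of_injective _ (fun a b hab => by simpa using hab)]
    simp
  · rw [Finset.card_insert_of_notMem (by simp),
      Finset.card_image_of_injective _ (fun a b hab => by simpa using hab)]
    simp

/-- The adjacency operator of `Z_k` on `ℓ²`. -/
def adjZ (k : ℕ) :
    lp (fun _ : LayerVertex ℤ k => ℂ) 2 →L[ℂ] lp (fun _ : LayerVertex ℤ k => ℂ) 2 :=
  (graphZ k).adjacencyOperator (k + 1) fun v => (graphZ_degree k v).le

/-- The spectral measure of `Z_k` at the vertex `v`: that of the adjacency operator at `δ_v`. -/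
def spectralMeasureZ (k : ℕ) (v : LayerVertex ℤ k) : MeasureTheory.Measure ℝ :=
  spectralMeasure (adjZ k) (lp.single 2 v (1 : ℂ))

end

/-!
Let `A` be the adjacency operator of `Z_k`, let `G` be the unitary involution exchanging the
values at `w_{i,j}` and `v_{i+1,j}`, and let `Q` average over the index `j`. Then `G A = 1 + k N`,
where `N` shifts the layers and satisfies `N* N = N N* = Q`. Conjugation by the unitary
multiplying the two sides of the `i`-th layer by `w ^ i` and `w ^ (-i)` turns `N` into `w N`, so
the spectrum of the normal operator `N` is rotation invariant and hence equals the unit circle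
together with `0`. Now `A ^ 2 = (G A)* (G A)`, and `σ(A) = -σ(A)` because the graph is bipartite;
therefore `σ(A)` consists of the numbers `± |1 + k z|` with `z ∈ σ(N)`.

If `A y = ± y`, then `z = Q y` satisfies `‖z + k N z‖ = ‖z‖` with `‖N z‖ = ‖z‖`, which for `k ≥ 2`
forces `N z = -z`. Then `|z|` is constant along the layers, so `Q y = 0` by square summability.
Hence `(1 ± G) (1 - Q) / 2` is the spectral projection of `A` at `± 1`, and its diagonal entries
are `(1 - 1 / k) / 2`. The measures of the two intervals follow, as the spectral measures at
vertices of a bipartite graph are symmetric.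
-/

section ClosedBalls

variable {V U : Type*} {G : SimpleGraph V} {H : SimpleGraph U}

theorem mem_closedBall_iff_exists_walk {x y : V} {r : ℕ} :
    y ∈ G.closedBall x r ↔ ∃ p : G.Walk x y, p.length ≤ r := by
  constructor
  · intro h
    have h' : G.edist x y ≤ r := h
    obtain ⟨p, hp⟩ := SimpleGraph.exists_walk_of_edist_ne_top
      (ne_top_of_le_ne_top (ENat.natCast_ne_top r) h')
    exact ⟨p, by rw [← hp] at h'; exact_mod_cast h'⟩
  · rintro ⟨p, hp⟩
    exact (SimpleGraph.edist_le p).trans (by exact_mod_cast hp)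

theorem closedBall_subset_closedBall_succ (x : V) (r : ℕ) :
    G.closedBall x r ⊆ G.closedBall x (r + 1) := fun _ hy => by
  obtain ⟨p, hp⟩ := mem_closedBall_iff_exists_walk.1 hy
  exact mem_closedBall_iff_exists_walk.2 ⟨p, by omega⟩

theorem mem_closedBall_succ_of_adj {x y z : V} {r : ℕ} (hy : y ∈ G.closedBall x r)
    (h : G.Adj y z) : z ∈ G.closedBall x (r + 1) := by
  obtain ⟨p, hp⟩ := mem_closedBall_iff_exists_walk.1 hy
  exact mem_closedBall_iff_exists_walk.2 ⟨p.concat h, by simpa using hp⟩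

theorem map_mem_closedBall (p : G →g H) {x y : V} {r : ℕ} (hy : y ∈ G.closedBall x r) :
    p y ∈ H.closedBall (p x) r := by
  obtain ⟨q, hq⟩ := mem_closedBall_iff_exists_walk.1 hy
  exact mem_closedBall_iff_exists_walk.2 ⟨q.map p, by simpa using hq⟩

theorem abs_sub_le_length_of_walk {f : V → ℤ} (hf : ∀ u v, G.Adj u v → |f u - f v| ≤ 1) {x y : V}
    (p : G.Walk x y) : |f x - f y| ≤ p.length := by
  induction p with
  | nil => simp
  | @cons u v w h p ih =>
    calc |f u - f w| ≤ |f u - f v| + |f v - f w| := abs_sub_le _ _ _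
      _ ≤ 1 + p.length := add_le_add (hf u v h) ih
      _ = _ := by rw [SimpleGraph.Walk.length_cons]; push_cast; ring

theorem abs_sub_le_of_mem_closedBall {f : V → ℤ} (hf : ∀ u v, G.Adj u v → |f u - f v| ≤ 1)
    {x y z : V} {r : ℕ} (hx : x ∈ G.closedBall z r) (hy : y ∈ G.closedBall z r) :
    |f x - f y| ≤ 2 * r := by
  obtain ⟨p, hp⟩ := mem_closedBall_iff_exists_walk.1 hx
  obtain ⟨q, hq⟩ := mem_closedBall_iff_exists_walk.1 hy
  have hzx := abs_sub_le_length_of_walk hf p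
  have hzy := abs_sub_le_length_of_walk hf q
  rw [abs_le] at *
  omega

variable {p : G →g H} (hlift : ∀ x y, H.Adj (p x) y → ∃ z, G.Adj x z ∧ p z = y)

include hlift

theorem exists_walk_lift {a b : U} (q : H.Walk a b) (x : V) (hx : p x = a) :
    ∃ (y : V) (q' : G.Walk x y), p y = b ∧ q'.length = q.length := by
  induction q generalizing x with
  | nil => exact ⟨x, .nil, hx, rfl⟩
  | cons h q ih =>
    subst hx
    obtain ⟨z, hz, hpz⟩ := hlift _ _ h
    obtain ⟨y, q', hy, hq'⟩ := ih z hpz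
    exact ⟨y, .cons hz q', hy, by simp [hq']⟩

theorem surjOn_closedBall (z : V) (r : ℕ) :
    Set.SurjOn p (G.closedBall z r) (H.closedBall (p z) r) := by
  intro b hb
  obtain ⟨q, hq⟩ := mem_closedBall_iff_exists_walk.1 hb
  obtain ⟨y, q', hy, hq'⟩ := exists_walk_lift hlift q z rfl
  exact ⟨y, mem_closedBall_iff_exists_walk.2 ⟨q', hq'.trans_le hq⟩, hy⟩

/-- Injectivity on the larger ball makes `p` reflect adjacency on the smaller one: the lift of an
edge of `H` ends in the larger ball. -/
theorem exists_closedBall_iso {z : V} {r : ℕ} (hinj : Set.InjOn p (G.closedBall z (r + 1))) :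
    ∃ φ : H.induce (H.closedBall (p z) r) ≃g G.induce (G.closedBall z r),
      φ ⟨p z, H.self_mem_closedBall _ r⟩ = ⟨z, G.self_mem_closedBall z r⟩ := by
  have hsub := closedBall_subset_closedBall_succ (G := G) z r
  have hbij : Set.BijOn p (G.closedBall z r) (H.closedBall (p z) r) :=
    ⟨fun _ => map_mem_closedBall p, hinj.mono hsub, surjOn_closedBall hlift z r⟩
  let ψ : G.induce (G.closedBall z r) ≃g H.induce (H.closedBall (p z) r) :=
    { toEquiv := hbij.equiv
      map_rel_iff' := by
        rintro ⟨x, hx⟩ ⟨y, hy⟩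
        refine ⟨fun h => ?_, p.map_adj⟩
        obtain ⟨y', hy', hpy⟩ := hlift x (p y) h
        rwa [hinj (mem_closedBall_succ_of_adj hx hy') (hsub hy) hpy] at hy' }
  exact ⟨ψ.symm, ψ.symm_apply_eq.2 rfl⟩

end ClosedBalls

section LayerGraphs

variable {I : Type} {k : ℕ}

/-- The automorphism of a layer graph that translates the layers by `a` and permutes the second
index by `σ`. -/
def layerShiftIso [AddCommGroupWithOne I] (a : I) (σ : Equiv.Perm (Fin k)) :
    layerGraph I k ≃g layerGraph I k where
  toEquiv := Equiv.sumCongr ((Equiv.addRight a).prodCongr σ) ((Equiv.addRight a).prodCongr σ)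
  map_rel_iff' := by
    rintro (⟨i, j⟩ | ⟨i, j⟩) (⟨i', l⟩ | ⟨i', l⟩) <;>
      simp [layerGraph, add_right_comm _ a 1, add_left_inj]

/-- The automorphism of a layer graph that exchanges `v_{i,j}` and `w_{-i,j}`. -/
def layerFlipIso [AddCommGroupWithOne I] : layerGraph I k ≃g layerGraph I k where
  toEquiv := (Equiv.sumComm _ _).trans (Equiv.sumCongr
    ((Equiv.neg I).prodCongr (Equiv.refl _)) ((Equiv.neg I).prodCongr (Equiv.refl _)))
  map_rel_iff' := by
    rintro (⟨i, j⟩ | ⟨i, j⟩) (⟨i', l⟩ | ⟨i', l⟩) <;>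
      simp [layerGraph] <;> grind

theorem layerGraph_isVertexTransitive [AddCommGroupWithOne I] :
    (layerGraph I k).IsVertexTransitive := by
  have hshift : ∀ (i i' : I) (j j' : Fin k), ∃ φ : layerGraph I k ≃g layerGraph I k,
      φ (.inl (i, j)) = .inl (i', j') ∧ φ (.inr (i, j)) = .inr (i', j') := fun i i' j j' =>
    ⟨layerShiftIso (i' - i) (Equiv.swap j j'), by simp [layerShiftIso], by simp [layerShiftIso]⟩
  rintro (⟨i, j⟩ | ⟨i, j⟩) (⟨i', j'⟩ | ⟨i', j'⟩)
  · obtain ⟨φ, h, -⟩ := hshift i i' j j'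
    exact ⟨φ, h⟩
  · obtain ⟨φ, -, h⟩ := hshift (-i) i' j j'
    exact ⟨layerFlipIso.trans φ, h⟩
  · obtain ⟨φ, h, -⟩ := hshift (-i) i' j j'
    exact ⟨layerFlipIso.trans φ, h⟩
  · obtain ⟨φ, -, h⟩ := hshift i i' j j'
    exact ⟨φ, h⟩

/-- The bipartition of a layer graph into the vertices `v_{i,j}` and `w_{i,j}`. -/
def layerBipartition [Add I] [One I] : (layerGraph I k).Coloring Bool :=
  .mk Sum.isLeft (by rintro (_ | _) (_ | _) h <;> first | exact h.elim | simp)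

/-- The layer `i` of the vertices `v_{i,j}` and `w_{i,j}`. -/
def vertexLayer : LayerVertex I k → I :=
  Sum.elim Prod.fst Prod.fst

theorem abs_vertexLayer_sub_le_one (x y : LayerVertex ℤ k) (h : (graphZ k).Adj x y) :
    |vertexLayer x - vertexLayer y| ≤ 1 := by
  rcases x with ⟨i, j⟩ | ⟨i, j⟩ <;> rcases y with ⟨i', l⟩ | ⟨i', l⟩ <;>
    simp only [layerGraph, vertexLayer, Sum.elim_inl, Sum.elim_inr] at h ⊢ <;> grind

/-- The covering `Z_k → W_{n,k}` reducing the first index modulo `n`. -/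
def layerCover (n k : ℕ) : graphZ k →g graphW n k where
  toFun := Sum.map (Prod.map Int.cast id) (Prod.map Int.cast id)
  map_rel' := by
    rintro (⟨i, j⟩ | ⟨i, j⟩) (⟨i', l⟩ | ⟨i', l⟩) h
    · exact h
    · exact h.imp (congrArg Int.cast) (And.imp_left fun hi => by simp [hi])
    · exact h.imp (congrArg Int.cast) (And.imp_left fun hi => by simp [hi])
    · exact h

theorem exists_adj_layerCover_eq (n : ℕ) (x : LayerVertex ℤ k) (y : LayerVertex (ZMod n) k)
    (h : (graphW n k).Adj (layerCover n k x) y) :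
    ∃ z, (graphZ k).Adj x z ∧ layerCover n k z = y := by
  rcases x with ⟨i, j⟩ | ⟨i, j⟩ <;> rcases y with ⟨i', l⟩ | ⟨i', l⟩
  · exact h.elim
  · rcases h with h | ⟨h, rfl⟩
    · exact ⟨.inr (i, l), Or.inl rfl, congrArg (fun a => Sum.inr (a, l)) h⟩
    · exact ⟨.inr (i - 1, j), Or.inr ⟨by ring, rfl⟩,
        congrArg (fun a => Sum.inr (a, j)) (by push_cast; exact sub_eq_of_eq_add h)⟩
  · rcases h with h | ⟨h, rfl⟩
    · exact ⟨.inl (i, l), Or.inl rfl, congrArg (fun a => Sum.inl (a, l)) h.symm⟩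
    · exact ⟨.inl (i + 1, l), Or.inr ⟨rfl, rfl⟩,
        congrArg (fun a => Sum.inl (a, l)) (by push_cast; exact h.symm)⟩
  · exact h.elim

theorem eq_of_layerCover_eq {n : ℕ} {x y : LayerVertex ℤ k}
    (hxy : |vertexLayer x - vertexLayer y| < n) (h : layerCover n k x = layerCover n k y) :
    x = y := by
  have hcast : ∀ a b : ℤ, |a - b| < n → (a : ZMod n) = b → a = b := fun a b hab heq =>
    sub_eq_zero.1 <| Int.eq_zero_of_abs_lt_dvd
      ((ZMod.intCast_zmod_eq_zero_iff_dvd _ _).1 (by simp [heq])) hab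
  rcases x with ⟨i, j⟩ | ⟨i, j⟩ <;> rcases y with ⟨i', l⟩ | ⟨i', l⟩
  · obtain ⟨hi, rfl⟩ : (i : ZMod n) = i' ∧ j = l := Prod.mk.inj (Sum.inl.inj h)
    rw [hcast i i' hxy hi]
  · exact (Sum.inl_ne_inr h).elim
  · exact (Sum.inr_ne_inl h).elim
  · obtain ⟨hi, rfl⟩ : (i : ZMod n) = i' ∧ j = l := Prod.mk.inj (Sum.inr.inj h)
    rw [hcast i i' hxy hi]

theorem isLocalLimit_graphW (k : ℕ) :
    SimpleGraph.IsLocalLimit (fun n => graphW n k) (graphZ k) := by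
  intro r
  filter_upwards [Filter.eventually_gt_atTop (2 * (r + 1))] with n hn x z
  obtain ⟨α, rfl⟩ := layerGraph_isVertexTransitive (layerCover n k z) x
  refine exists_closedBall_iso (p := α.toHom.comp (layerCover n k)) (fun x y h => ?_) ?_
  · obtain ⟨z, hz, hy⟩ := exists_adj_layerCover_eq n x (α.symm y)
      (by rw [← α.map_adj_iff]; simpa using h)
    exact ⟨z, hz, by simp [hy]⟩
  · intro x hx y hy hxy
    have hdist := abs_sub_le_of_mem_closedBall abs_vertexLayer_sub_le_one hx hy
    exact eq_of_layerCover_eq (by omega) (α.injective hxy)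

end LayerGraphs

section SpectralMeasures

open MeasureTheory Filter Topology

theorem tendsto_integral_pow {α : Type*} [MeasurableSpace α] {μ : Measure α} [IsFiniteMeasure μ]
    {h : α → ℝ} (hm : Measurable h) (h0 : ∀ t, 0 ≤ h t) (h1 : ∀ t, h t ≤ 1) :
    Tendsto (fun n : ℕ => ∫ t, h t ^ n ∂μ) atTop (𝓝 (μ.real (h ⁻¹' {1}))) := by
  rw [← integral_indicator_one (hm (measurableSet_singleton 1))]
  refine tendsto_integral_of_dominated_convergence (fun _ => 1)
    (fun n => (hm.pow_const n).aestronglyMeasurable) (integrable_const _) (fun n => ?_) ?_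
  · refine .of_forall fun t => ?_
    rw [Real.norm_eq_abs, abs_of_nonneg (pow_nonneg (h0 t) n)]
    exact pow_le_one₀ (h0 t) (h1 t)
  · refine .of_forall fun t => ?_
    by_cases ht : h t = 1
    · simp [ht]
    · rw [Set.indicator_of_notMem (by simpa using ht)]
      exact tendsto_pow_atTop_nhds_zero_of_lt_one (h0 t) ((h1 t).lt_of_ne ht)

theorem measure_Ioi_zero_of_map_neg_eq {μ : Measure ℝ} [IsProbabilityMeasure μ]
    (hneg : μ.map (fun t => -t) = μ) (h0 : μ {0} = 0) : μ (Set.Ioi 0) = ENNReal.ofReal (1 / 2) := by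
  have hIio : μ.real (Set.Iio 0) = μ.real (Set.Ioi 0) := by
    conv_rhs => rw [← hneg, map_measureReal_apply measurable_neg measurableSet_Ioi]
    congr 1
    ext t
    simp
  have hIic : μ.real (Set.Iic 0) = μ.real (Set.Iio 0) :=
    measureReal_congr (Iio_ae_eq_Iic' h0).symm
  have hcompl : μ.real (Set.Iic 0) = 1 - μ.real (Set.Ioi 0) := by
    rw [← Set.compl_Ioi, probReal_compl_eq_one_sub measurableSet_Ioi]
  rw [← ofReal_measureReal]
  congr 1
  linarith

variable {H : Type*} [NormedAddCommGroup H] [InnerProductSpace ℂ H] [CompleteSpace H]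
  {A : H →L[ℂ] H}

theorem integral_spectralMeasure (A : H →L[ℂ] H) (x : H) (f : C_c(ℝ, ℝ)) :
    ∫ t, f t ∂(spectralMeasure A x) = (inner ℂ x (cfc (f : ℝ → ℝ) A x)).re :=
  RealRMK.integral_rieszMeasure (spectralFunctional A x) f

instance regular_spectralMeasure (A : H →L[ℂ] H) (x : H) : (spectralMeasure A x).Regular :=
  RealRMK.regular_rieszMeasure (spectralFunctional A x)

theorem spectralMeasure_compl_spectrum (A : H →L[ℂ] H) (x : H) :
    spectralMeasure A x (spectrum ℝ A)ᶜ = 0 := by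
  have hopen : IsOpen (spectrum ℝ A)ᶜ := (spectrum.isClosed A).isOpen_compl
  rw [hopen.measure_eq_iSup_isCompact]
  simp only [ENNReal.iSup_eq_zero]
  intro K hK hKc
  obtain ⟨f, hf1, hfc, hfs, hf01⟩ :=
    exists_continuousMap_one_of_isCompact_subset_isOpen hKc hopen hK
  have hcfc : cfc (f : ℝ → ℝ) A = 0 := by
    rw [cfc_congr (g := fun _ => (0 : ℝ)), cfc_const_zero]
    intro t ht
    by_contra hne
    exact hfs (subset_tsupport _ hne) ht
  have hzero : spectralFunctional A x ⟨f, hfc⟩ = 0 := by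
    change (inner ℂ x (cfc (f : ℝ → ℝ) A x)).re = 0
    simp [hcfc]
  have hle := RealRMK.rieszMeasure_le_of_eq_one (spectralFunctional A x)
    (f := ⟨f, hfc⟩) (fun t => (hf01 t).1) hKc (fun t ht => hf1 ht)
  rw [hzero, ENNReal.ofReal_zero] at hle
  exact le_antisymm hle zero_le

theorem ae_mem_spectrum (A : H →L[ℂ] H) (x : H) :
    ∀ᵐ t ∂(spectralMeasure A x), t ∈ spectrum ℝ A :=
  spectralMeasure_compl_spectrum A x

instance isFiniteMeasure_spectralMeasure (A : H →L[ℂ] H) (x : H) :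
    IsFiniteMeasure (spectralMeasure A x) := by
  constructor
  rw [← Set.union_compl_self (spectrum ℝ A)]
  refine (measure_union_le _ _).trans_lt ?_
  rw [spectralMeasure_compl_spectrum, add_zero]
  exact (spectrum.isCompact A).measure_lt_top

theorem integral_spectralMeasure_of_continuous (A : H →L[ℂ] H) (x : H) {f : ℝ → ℝ}
    (hf : Continuous f) :
    ∫ t, f t ∂(spectralMeasure A x) = (inner ℂ x (cfc f A x)).re := by
  obtain ⟨χ, hχ1, hχc, -, -⟩ := exists_continuousMap_one_of_isCompact_subset_isOpen
    (spectrum.isCompact (𝕜 := ℝ) A) isOpen_univ (Set.subset_univ _)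
  let g : C_c(ℝ, ℝ) := ⟨⟨fun t => χ t * f t, by fun_prop⟩,
    HasCompactSupport.mul_right (f := χ) (f' := f) hχc⟩
  have hg : Set.EqOn g f (spectrum ℝ A) := fun t ht => by
    change χ t * f t = f t
    rw [hχ1 ht, Pi.one_apply, one_mul]
  rw [← cfc_congr hg, ← integral_spectralMeasure]
  refine integral_congr_ae ?_
  filter_upwards [ae_mem_spectrum A x] with t ht
  exact (hg ht).symm

theorem spectralMeasure_univ (hA : IsSelfAdjoint A) (x : H) :
    spectralMeasure A x Set.univ = ENNReal.ofReal (‖x‖ ^ 2) := by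
  have h := integral_spectralMeasure_of_continuous A x (f := fun _ => 1) continuous_const
  rw [cfc_const_one ℝ A] at h
  simp only [integral_const, smul_eq_mul, mul_one, one_apply_eq_self] at h
  rw [← ofReal_measureReal, h, inner_self_eq_norm_sq_to_K]
  norm_cast

theorem isProbabilityMeasure_spectralMeasure (hA : IsSelfAdjoint A) {x : H} (hx : ‖x‖ = 1) :
    IsProbabilityMeasure (spectralMeasure A x) :=
  ⟨by simp [spectralMeasure_univ hA, hx]⟩

theorem spectralMeasure_neg (hA : IsSelfAdjoint A) (x : H) :
    spectralMeasure (-A) x = (spectralMeasure A x).map (fun t => -t) := by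
  have hreg : ((spectralMeasure A x).map (fun t => -t)).Regular :=
    Measure.Regular.map (μ := spectralMeasure A x) (Homeomorph.neg ℝ)
  refine Measure.ext_of_integral_eq_on_compactlySupported fun f => ?_
  rw [integral_map (by fun_prop) (by fun_prop), integral_spectralMeasure,
    integral_spectralMeasure_of_continuous A x (f := fun t => f (-t)) (by fun_prop),
    cfc_comp_neg f A f.continuous.continuousOn]

theorem cfc_unitary_conjugate {f : ℝ → ℝ} (hf : Continuous f) (hA : IsSelfAdjoint A)
    {U : H →L[ℂ] H} (hU : U ∈ unitary (H →L[ℂ] H)) :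
    cfc f (U * A * star U) = U * cfc f A * star U := by
  have h := StarAlgHomClass.map_cfc (S := ℂ) (Unitary.conjStarAlgAut ℂ (H →L[ℂ] H) ⟨U, hU⟩) f A
    hf.continuousOn
    (by
      change Continuous fun a : H →L[ℂ] H => U * a * star U
      fun_prop)
    hA (hA.conjugate U)
  rw [Unitary.conjStarAlgAut_apply, Unitary.conjStarAlgAut_apply] at h
  exact h.symm

theorem spectralMeasure_unitary_conjugate (hA : IsSelfAdjoint A) {U : H →L[ℂ] H}
    (hU : U ∈ unitary (H →L[ℂ] H)) (x : H) :
    spectralMeasure (U * A * star U) (U x) = spectralMeasure A x := by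
  have hUx : star U (U x) = x :=
    congrArg (fun T : H →L[ℂ] H => T x) (Unitary.star_mul_self_of_mem hU)
  refine Measure.ext_of_integral_eq_on_compactlySupported fun f => ?_
  rw [integral_spectralMeasure, integral_spectralMeasure,
    cfc_unitary_conjugate (f := f) f.continuous hA hU, mul_apply_eq_comp, mul_apply_eq_comp,
    hUx, ← ContinuousLinearMap.adjoint_inner_left, ← ContinuousLinearMap.star_eq_adjoint, hUx]

/-- By von Neumann's mean ergodic theorem, the Cesàro means of the moments `∫ hⁿ = ⟨x, h(A)ⁿ x⟩`
converge to the right-hand side. -/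
theorem spectralMeasure_preimage_one (hA : IsSelfAdjoint A) (x : H) {h : ℝ → ℝ}
    (hc : Continuous h) (h0 : ∀ t, 0 ≤ h t) (h1 : ∀ t, h t ≤ 1) :
    spectralMeasure A x (h ⁻¹' {1}) =
      ENNReal.ofReal (‖((cfc h A).eqLocus (1 : H →L[ℂ] H)).starProjection x‖ ^ 2) := by
  set K := (cfc h A).eqLocus (1 : H →L[ℂ] H)
  have hcontr : ‖cfc h A‖ ≤ 1 := norm_cfc_le zero_le_one fun t _ => by
    rw [Real.norm_eq_abs, abs_of_nonneg (h0 t)]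
    exact h1 t
  have hmoment : ∀ n : ℕ,
      (inner ℂ x ((cfc h A ^ n) x)).re = ∫ t, h t ^ n ∂(spectralMeasure A x) := fun n => by
    rw [integral_spectralMeasure_of_continuous A x (f := fun t => h t ^ n) (hc.pow n),
      cfc_pow h n A]
  have hergodic : Tendsto (fun n : ℕ => (n⁻¹ : ℝ) * ∑ i ∈ Finset.range n,
      ∫ t, h t ^ i ∂(spectralMeasure A x)) atTop (𝓝 (inner ℂ x (K.starProjection x)).re) := by
    refine ((Complex.continuous_re.tendsto _).comp ((tendsto_const_nhds (x := x)).inner (𝕜 := ℂ)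
      ((cfc h A).tendsto_birkhoffAverage_orthogonalProjection hcontr x))).congr fun n => ?_
    have hcast : ((n : ℂ)⁻¹) = ((n : ℝ)⁻¹ : ℝ) := by push_cast; rfl
    simp only [← hmoment, Function.comp_apply, birkhoffAverage, birkhoffSum, inner_smul_right,
      inner_sum, id_eq, hcast, Complex.re_ofReal_mul, Complex.re_sum,
      FunLike.coe_pow_eq_iterate]
  have hinner : (inner ℂ x (K.starProjection x)).re = ‖K.starProjection x‖ ^ 2 :=
    (inner_re_symm x _).trans (K.re_inner_starProjection_eq_normSq x)
  rw [← ofReal_measureReal, tendsto_nhds_unique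
    (tendsto_integral_pow hc.measurable h0 h1).cesaro hergodic, hinner]

/-- The Lorentzian `t ↦ 1 / (1 + (t - c)²)`, a continuous function with values in `(0, 1]` that
peaks at `c` alone. -/
noncomputable def lorentzian (c t : ℝ) : ℝ := (1 + (t - c) ^ 2)⁻¹

theorem continuous_lorentzian (c : ℝ) : Continuous (lorentzian c) :=
  Continuous.inv₀ (by fun_prop) fun t => by positivity

theorem lorentzian_nonneg (c t : ℝ) : 0 ≤ lorentzian c t := by
  unfold lorentzian
  positivity

theorem lorentzian_le_one (c t : ℝ) : lorentzian c t ≤ 1 :=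
  inv_le_one_of_one_le₀ (by nlinarith [sq_nonneg (t - c)])

theorem lorentzian_eq_one_iff {c t : ℝ} : lorentzian c t = 1 ↔ t = c := by
  simp [lorentzian, sub_eq_zero]

theorem cfc_lorentzian_mul (hA : IsSelfAdjoint A) (c : ℝ) :
    cfc (lorentzian c) A * (1 + (A - algebraMap ℝ (H →L[ℂ] H) c) ^ 2) = 1 := by
  have hcont := continuous_lorentzian c
  have hsub : cfc (fun t : ℝ => t - c) A = A - algebraMap ℝ (H →L[ℂ] H) c := by
    rw [cfc_sub (a := A) (fun t : ℝ => t) (fun _ => c), cfc_id' ℝ A, cfc_const c A]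
  have hden : cfc (fun t : ℝ => 1 + (t - c) ^ 2) A = 1 + (A - algebraMap ℝ (H →L[ℂ] H) c) ^ 2 := by
    rw [cfc_add (a := A) (fun _ : ℝ => 1) (fun t => (t - c) ^ 2), cfc_const_one ℝ A,
      cfc_pow (fun t : ℝ => t - c) 2 A, hsub]
  rw [← hden, ← cfc_mul (lorentzian c) _ A, ← cfc_const_one ℝ A]
  exact cfc_congr fun t _ => inv_mul_cancel₀ (by positivity)

theorem eqLocus_cfc_lorentzian (hA : IsSelfAdjoint A) (c : ℝ) :
    (cfc (lorentzian c) A).eqLocus (1 : H →L[ℂ] H) = A.eqLocus (algebraMap ℝ (H →L[ℂ] H) c) := by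
  set B := cfc (lorentzian c) A
  set C := A - algebraMap ℝ (H →L[ℂ] H) c
  have hC : IsSelfAdjoint C := hA.sub (.algebraMap _ (.all c))
  have hBC : B * (1 + C ^ 2) = 1 := cfc_lorentzian_mul hA c
  have hCB : (1 + C ^ 2) * B = 1 := by
    simpa [hC.star_eq, (cfc_predicate (lorentzian c) A).star_eq, B] using congrArg star hBC
  ext y
  change B y = y ↔ A y = algebraMap ℝ (H →L[ℂ] H) c y
  rw [← sub_eq_zero (a := A y), ← sub_apply]
  change _ ↔ C y = 0
  constructor
  · intro hy
    have hCC : C (C y) = 0 := by simpa [hy, sq] using DFunLike.congr_fun hCB y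
    rw [← inner_self_eq_zero (𝕜 := ℂ)]
    exact (hC.isSymmetric y (C y)).trans (by simp [hCC])
  · intro hy
    simpa [hy, sq] using DFunLike.congr_fun hBC y

theorem spectralMeasure_singleton (hA : IsSelfAdjoint A) (x : H) (c : ℝ) :
    spectralMeasure A x {c} =
      ENNReal.ofReal (‖(A.eqLocus (algebraMap ℝ (H →L[ℂ] H) c)).starProjection x‖ ^ 2) := by
  have hpeak : lorentzian c ⁻¹' {1} = {c} := Set.ext fun _ => lorentzian_eq_one_iff
  rw [← hpeak, spectralMeasure_preimage_one hA x (continuous_lorentzian c) (lorentzian_nonneg c)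
    (lorentzian_le_one c)]
  simp only [eqLocus_cfc_lorentzian hA c]

end SpectralMeasures

section Spectra

open Complex Metric

theorem image_norm_sphere {E : Type*} [NormedAddCommGroup E] [NormedSpace ℝ E]
    (hE : 1 < Module.rank ℝ E) (a : E) {r : ℝ} (hr : 0 ≤ r) :
    norm '' sphere a r = Set.Icc |‖a‖ - r| (‖a‖ + r) := by
  have : Nontrivial E := (rank_pos_iff_nontrivial (R := ℝ)).1 (zero_lt_one.trans hE)
  obtain ⟨u, hu, hau⟩ : ∃ u : E, ‖u‖ = 1 ∧ a = ‖a‖ • u := by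
    rcases eq_or_ne a 0 with rfl | ha
    · obtain ⟨u, hu⟩ := exists_norm_eq E zero_le_one
      exact ⟨u, hu, by simp⟩
    · exact ⟨‖a‖⁻¹ • a, norm_smul_inv_norm ha, by simp [smul_smul, ha]⟩
  have hmem : ∀ t : ℝ, |t| = r → a + t • u ∈ sphere a r ∧ ‖a + t • u‖ = |‖a‖ + t| := by
    refine fun t ht => ⟨by simp [norm_smul, hu, ht], ?_⟩
    nth_rw 1 [hau]
    rw [← add_smul, norm_smul, hu, mul_one, Real.norm_eq_abs]
  obtain ⟨hfar, hfar_norm⟩ := hmem r (abs_of_nonneg hr)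
  obtain ⟨hnear, hnear_norm⟩ := hmem (-r) (by rw [abs_neg, abs_of_nonneg hr])
  rw [abs_of_nonneg (by positivity)] at hfar_norm
  rw [← sub_eq_add_neg] at hnear_norm
  refine Set.Subset.antisymm ?_ ?_
  · rintro _ ⟨x, hx, rfl⟩
    rw [mem_sphere_iff_norm] at hx
    refine ⟨?_, ?_⟩
    · rw [← hx, abs_le]
      exact ⟨by linarith [norm_sub_le x a],
        by linarith [norm_le_norm_add_norm_sub' a x, norm_sub_rev a x]⟩
    · rw [← hx]
      simpa using norm_add_le a (x - a)
  · rw [← hnear_norm, ← hfar_norm]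
    exact (isPreconnected_sphere hE a r).intermediate_value hnear hfar continuous_norm.continuousOn

section Algebra

variable {𝕜 𝓐 : Type*} [Field 𝕜] [Ring 𝓐] [Algebra 𝕜 𝓐]

theorem spectrum_of_isIdempotentElem {q : 𝓐} (hq : IsIdempotentElem q)
    (h0 : q ≠ 0) (h1 : q ≠ 1) : spectrum 𝕜 q = {0, 1} := by
  refine (hq.spectrum_subset 𝕜).antisymm ?_
  rintro z (rfl | rfl)
  · rw [spectrum.zero_mem_iff]
    exact fun h => h1 ((IsIdempotentElem.iff_eq_one_of_isUnit h).1 hq)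
  · rw [spectrum.mem_iff, map_one]
    intro h
    exact h0 (by simpa using (IsIdempotentElem.iff_eq_one_of_isUnit h).1 hq.one_sub)

theorem spectrum_one_add_smul {c : 𝕜} (hc : c ≠ 0) (a : 𝓐) :
    spectrum 𝕜 (1 + c • a) = (fun z => 1 + c * z) '' spectrum 𝕜 a := by
  have hadd := spectrum.singleton_add_eq (c • a) (1 : 𝕜)
  have hsmul := spectrum.unit_smul_eq_smul a (Units.mk0 c hc)
  simp only [Units.smul_def, Units.val_mk0] at hsmul
  rw [map_one, hsmul] at hadd
  rw [← hadd, Set.singleton_add, ← Set.image_smul, Set.image_image]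
  rfl

theorem mem_spectrum_iff_sq_mem_spectrum_sq [IsAlgClosed 𝕜] {a : 𝓐}
    (ha : spectrum 𝕜 (-a) = spectrum 𝕜 a) {z : 𝕜} :
    z ∈ spectrum 𝕜 a ↔ z ^ 2 ∈ spectrum 𝕜 (a ^ 2) := by
  rw [spectrum.map_pow_of_pos a two_pos]
  refine ⟨fun hz => ⟨z, hz, rfl⟩, ?_⟩
  rintro ⟨w, hw, hwz⟩
  rcases sq_eq_sq_iff_eq_or_eq_neg.1 hwz with rfl | rfl
  · exact hw
  · rw [← ha, ← spectrum.neg_eq]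
    simpa using hw

end Algebra

variable {𝓐 : Type*} [CStarAlgebra 𝓐] {a m : 𝓐}

theorem spectrum_star_mul_self (a : 𝓐) [IsStarNormal a] :
    spectrum ℂ (star a * a) = (fun z : ℂ => (‖z‖ : ℂ) ^ 2) '' spectrum ℂ a := by
  have hcfc : star a * a = cfc (fun z : ℂ => star z * z) a := by
    rw [cfc_mul (fun z : ℂ => star z) (fun z => z) a, cfc_star (fun z => z) a, cfc_id' ℂ a]
  rw [hcfc, cfc_map_spectrum (fun z : ℂ => star z * z) a]
  exact Set.image_congr fun z _ => conj_mul' z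

theorem spectrum_eq_of_neg_of_sq_eq_star_mul_self [IsStarNormal m]
    (ha : spectrum ℂ (-a) = spectrum ℂ a) (ham : a ^ 2 = star m * m) :
    spectrum ℂ a = (fun t : ℝ => (t : ℂ)) '' {t | |t| ∈ norm '' spectrum ℂ m} := by
  ext z
  rw [mem_spectrum_iff_sq_mem_spectrum_sq ha, ham, spectrum_star_mul_self]
  constructor
  · rintro ⟨w, hw, hwz⟩
    rcases sq_eq_sq_iff_eq_or_eq_neg.1 hwz.symm with rfl | rfl
    · exact ⟨‖w‖, ⟨w, hw, by simp⟩, rfl⟩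
    · exact ⟨-‖w‖, ⟨w, hw, by simp⟩, by simp⟩
  · rintro ⟨t, ⟨w, hw, hwt⟩, rfl⟩
    refine ⟨w, hw, ?_⟩
    simp only [hwt]
    norm_cast
    exact sq_abs t

theorem spectrum_of_isStarNormal_of_rotation [IsStarNormal a]
    (hidem : IsIdempotentElem (star a * a)) (h0 : star a * a ≠ 0) (h1 : star a * a ≠ 1)
    (hrot : ∀ w : ℂ, ‖w‖ = 1 → spectrum ℂ (w • a) = spectrum ℂ a) :
    spectrum ℂ a = insert 0 (sphere 0 1) := by
  have hsq := (spectrum_star_mul_self a).symm.trans (spectrum_of_isIdempotentElem hidem h0 h1)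
  have hnorm : ∀ z : ℂ, (‖z‖ : ℂ) ^ 2 ∈ ({0, 1} : Set ℂ) ↔ z ∈ insert 0 (sphere (0 : ℂ) 1) :=
    fun z => by
      rw [Set.mem_insert_iff, Set.mem_singleton_iff, Set.mem_insert_iff, mem_sphere_zero_iff_norm]
      norm_cast
      rw [sq_eq_zero_iff, norm_eq_zero, pow_eq_one_iff_of_nonneg (norm_nonneg z) two_ne_zero]
  refine Set.Subset.antisymm (fun z hz => (hnorm z).1 (hsq ▸ ⟨z, hz, rfl⟩)) ?_
  rintro w (rfl | hw)
  · obtain ⟨z, hz, hz_norm⟩ : (0 : ℂ) ∈ (fun z : ℂ => (‖z‖ : ℂ) ^ 2) '' spectrum ℂ a := by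
      simp [hsq]
    obtain rfl : z = 0 := by simpa using hz_norm
    exact hz
  · obtain ⟨z, hz, (hz_norm : (‖z‖ : ℂ) ^ 2 = 1)⟩ :
        (1 : ℂ) ∈ (fun z : ℂ => (‖z‖ : ℂ) ^ 2) '' spectrum ℂ a := by
      simp [hsq]
    have hz1 : ‖z‖ = 1 := by
      norm_cast at hz_norm
      exact (pow_eq_one_iff_of_nonneg (norm_nonneg z) two_ne_zero).1 hz_norm
    have hz0 : z ≠ 0 := norm_ne_zero_iff.1 (by simp [hz1])
    have hwz : w / z ≠ 0 := div_ne_zero (ne_zero_of_mem_unit_sphere ⟨w, hw⟩) hz0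
    rw [mem_sphere_zero_iff_norm] at hw
    rw [← hrot (w / z) (by simp [hw, hz1])]
    have h := spectrum.smul_mem_smul_iff (r := Units.mk0 (w / z) hwz) |>.2 hz
    simpa [Units.smul_def, hz0] using h

end Spectra

section EllTwo

variable {V : Type*}

/-- The Hilbert space `ℓ²(V)` of square-summable functions `V → ℂ`. -/
abbrev EllTwo (V : Type*) : Type _ := lp (fun _ : V => ℂ) 2

theorem ellTwo_add_apply (f g : EllTwo V) (v : V) : (f + g) v = f v + g v := rfl

theorem ellTwo_sub_apply (f g : EllTwo V) (v : V) : (f - g) v = f v - g v := rfl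

theorem ellTwo_smul_apply (c : ℂ) (f : EllTwo V) (v : V) : (c • f) v = c * f v := rfl

theorem summable_norm_sq (f : EllTwo V) : Summable fun v => ‖f v‖ ^ 2 := by
  simpa using (memℓp_gen_iff (p := 2) (by norm_num)).1 (lp.memℓp f)

theorem eq_zero_of_norm_apply_eq {f : EllTwo V} {σ : V → V}
    (hf : ∀ v, ‖f (σ v)‖ = ‖f v‖) {v : V} (hv : Function.Injective fun n : ℕ => σ^[n] v) :
    f v = 0 := by
  have hconst : ∀ n : ℕ, ‖f (σ^[n] v)‖ = ‖f v‖ := fun n => by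
    induction n with
    | zero => rfl
    | succ n ih => rw [Function.iterate_succ_apply', hf, ih]
  have hsum := (summable_norm_sq f).comp_injective hv
  simpa [Function.comp_def, hconst, summable_const_iff] using hsum

theorem norm_circle_mul (c : Circle) (z : ℂ) : ‖(c : ℂ) * z‖ = ‖z‖ := by
  rw [norm_mul, Circle.norm_coe, one_mul]

theorem memℓp_circle_mul_comp (s : V → Circle) (σ : Equiv.Perm V) (f : EllTwo V) :
    Memℓp (fun v => (s v : ℂ) * f (σ v)) 2 := by
  rw [memℓp_gen_iff (by norm_num)]
  refine (σ.summable_iff.2 (summable_norm_sq f)).congr fun v => ?_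
  rw [ENNReal.toReal_ofNat, Real.rpow_ofNat]
  exact congrArg (· ^ 2) (norm_circle_mul _ _).symm

/-- The unitary operator `f ↦ s • (f ∘ σ)` of `ℓ²(V)`. -/
noncomputable def weightedPerm (s : V → Circle) (σ : Equiv.Perm V) :
    unitary (EllTwo V →L[ℂ] EllTwo V) :=
  Unitary.linearIsometryEquiv.symm <| LinearIsometryEquiv.ofSurjective
    { toFun f := ⟨fun v => s v * f (σ v), memℓp_circle_mul_comp s σ f⟩
      map_add' f g := by
        ext v
        exact mul_add _ _ _
      map_smul' c f := by
        ext v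
        exact mul_left_comm _ _ _
      norm_map' f := by
        rw [lp.norm_eq_tsum_rpow (by norm_num), lp.norm_eq_tsum_rpow (by norm_num)]
        congr 1
        rw [← σ.tsum_eq fun v => ‖f v‖ ^ (2 : ℝ≥0∞).toReal]
        exact tsum_congr fun v => congrArg (· ^ _) (norm_circle_mul _ _) }
    fun g => ⟨⟨_, memℓp_circle_mul_comp (fun v => (s (σ.symm v))⁻¹) σ.symm g⟩, by
      ext v
      simp⟩

@[simp]
theorem weightedPerm_apply (s : V → Circle) (σ : Equiv.Perm V) (f : EllTwo V) (v : V) :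
    (weightedPerm s σ : EllTwo V →L[ℂ] EllTwo V) f v = s v * f (σ v) := rfl

theorem isSelfAdjoint_of_single_apply [DecidableEq V] {T : EllTwo V →L[ℂ] EllTwo V}
    (hT : ∀ u v, star (T (lp.single 2 u 1) v) = T (lp.single 2 v 1) u) : IsSelfAdjoint T := by
  refine lp.ext_continuousLinearMap (by norm_num) fun v => ?_
  ext u
  have h : inner ℂ (lp.single 2 u 1) (star T (lp.single 2 v 1)) = star (T (lp.single 2 u 1) v) := by
    rw [ContinuousLinearMap.star_eq_adjoint, ContinuousLinearMap.adjoint_inner_right,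
      lp.inner_single_right]
    simp
  rw [lp.inner_single_left] at h
  simpa [hT] using h

end EllTwo

section AdjacencyOperators

variable {V : Type*} {G : SimpleGraph V} [G.LocallyFinite] {d : ℕ} (hd : ∀ v, G.degree v ≤ d)

theorem isSelfAdjoint_adjacencyOperator : IsSelfAdjoint (G.adjacencyOperator d hd) := by
  classical
  refine isSelfAdjoint_of_single_apply fun u v => ?_
  simp only [SimpleGraph.adjacencyOperator_apply, lp.single_apply]
  simp [Pi.single_apply, G.adj_comm]

/-- The sign changes from a vertex to its neighbours, so `U` anticommutes with `A`. -/
theorem exists_unitary_conjugate_adjacencyOperator_eq_neg (C : G.Coloring Bool) (v : V)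
    [DecidableEq V] :
    ∃ U ∈ unitary (EllTwo V →L[ℂ] EllTwo V),
      U * G.adjacencyOperator d hd * star U = -G.adjacencyOperator d hd ∧
        U (lp.single 2 v 1) = lp.single 2 v 1 := by
  let s : V → Circle := fun u => if C u = C v then 1 else -1
  let U : EllTwo V →L[ℂ] EllTwo V := weightedPerm s (Equiv.refl V)
  have hU : U ∈ unitary (EllTwo V →L[ℂ] EllTwo V) := (weightedPerm s (Equiv.refl V)).2
  have hs : ∀ {u w}, G.Adj u w → s w = -s u := fun {u w} h => by
    have := C.valid h
    simp only [s]
    cases hu : C u <;> cases hw : C w <;> cases hv : C v <;> simp_all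
  have hanti : U * G.adjacencyOperator d hd = -G.adjacencyOperator d hd * U := by
    ext f u
    simp only [mul_apply_eq_comp, neg_apply, lp.coeFn_neg, Pi.neg_apply, U, weightedPerm_apply,
      Equiv.refl_apply, SimpleGraph.adjacencyOperator_apply, Finset.mul_sum,
      ← Finset.sum_neg_distrib]
    refine Finset.sum_congr rfl fun w hw => ?_
    rw [hs ((G.mem_neighborFinset _ _).1 hw)]
    simp
  refine ⟨U, hU, ?_, ?_⟩
  · rw [hanti, mul_assoc, Unitary.mul_star_self_of_mem hU, mul_one]
  · ext u
    rcases eq_or_ne u v with rfl | h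
    · simp [U, s]
    · simp [U, h]

theorem spectrum_neg_adjacencyOperator (C : G.Coloring Bool) :
    spectrum ℂ (-G.adjacencyOperator d hd) = spectrum ℂ (G.adjacencyOperator d hd) := by
  classical
  rcases isEmpty_or_nonempty V with hV | ⟨⟨v⟩⟩
  · congr 1
    exact Subsingleton.elim _ _
  obtain ⟨U, hU, hneg, -⟩ := exists_unitary_conjugate_adjacencyOperator_eq_neg hd C v
  rw [← hneg]
  exact Unitary.spectrum_star_right_conjugate (U := ⟨U, hU⟩)

theorem map_neg_spectralMeasure_adjacencyOperator (C : G.Coloring Bool) [DecidableEq V] (v : V) :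
    (spectralMeasure (G.adjacencyOperator d hd) (lp.single 2 v 1)).map (fun t => -t) =
      spectralMeasure (G.adjacencyOperator d hd) (lp.single 2 v 1) := by
  obtain ⟨U, hU, hneg, hfix⟩ := exists_unitary_conjugate_adjacencyOperator_eq_neg hd C v
  have hA := isSelfAdjoint_adjacencyOperator hd
  rw [← spectralMeasure_neg hA, ← hneg]
  nth_rw 1 [← hfix]
  exact spectralMeasure_unitary_conjugate hA hU _

end AdjacencyOperators

section LayerOperators

variable {k : ℕ}

theorem adjZ_apply (f : EllTwo (LayerVertex ℤ k)) (x : LayerVertex ℤ k) :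
    adjZ k f x = ∑ y ∈ graphZNeighbors k x, f y := by
  refine Finset.sum_congr ?_ fun _ _ => rfl
  ext y
  rw [mem_graphZNeighbors, SimpleGraph.mem_neighborFinset, SimpleGraph.mem_neighborSet]

theorem adjZ_inl (f : EllTwo (LayerVertex ℤ k)) (i : ℤ) (j : Fin k) :
    adjZ k f (.inl (i, j)) = f (.inr (i - 1, j)) + ∑ l, f (.inr (i, l)) := by
  rw [adjZ_apply, graphZNeighbors, Finset.sum_insert (by simp; omega),
    Finset.sum_image fun _ _ _ _ h => by simpa using h]

theorem adjZ_inr (f : EllTwo (LayerVertex ℤ k)) (i : ℤ) (j : Fin k) :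
    adjZ k f (.inr (i, j)) = f (.inl (i + 1, j)) + ∑ l, f (.inl (i, l)) := by
  rw [adjZ_apply, graphZNeighbors, Finset.sum_insert (by simp),
    Finset.sum_image fun _ _ _ _ h => by simpa using h]

/-- The permutation exchanging `v_{i,j}` and `w_{i,j}`. -/
def flipPerm (k : ℕ) : Equiv.Perm (LayerVertex ℤ k) := Equiv.sumComm _ _

/-- The permutation exchanging `w_{i,j}` and `v_{i+1,j}`. -/
def linkPerm (k : ℕ) : Equiv.Perm (LayerVertex ℤ k) :=
  Function.Involutive.toPerm
    (Sum.elim (fun p => .inr (p.1 - 1, p.2)) fun p => .inl (p.1 + 1, p.2))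
    (by rintro (_ | _) <;> simp)

/-- The unitary operator permuting the basis of `ℓ²` by `flipPerm`. -/
noncomputable def flipOp (k : ℕ) : EllTwo (LayerVertex ℤ k) →L[ℂ] EllTwo (LayerVertex ℤ k) :=
  weightedPerm 1 (flipPerm k)

/-- The unitary operator permuting the basis of `ℓ²` by `linkPerm`. -/
noncomputable def linkOp (k : ℕ) : EllTwo (LayerVertex ℤ k) →L[ℂ] EllTwo (LayerVertex ℤ k) :=
  weightedPerm 1 (linkPerm k)

/-- The projection averaging a function over each set `{v_{i,j} | j}` and each set
`{w_{i,j} | j}`. -/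
noncomputable def meanOp (k : ℕ) : EllTwo (LayerVertex ℤ k) →L[ℂ] EllTwo (LayerVertex ℤ k) :=
  (k : ℂ)⁻¹ • (flipOp k * (adjZ k - linkOp k))

variable (f : EllTwo (LayerVertex ℤ k))

@[simp]
theorem flipOp_inl (p : ℤ × Fin k) : flipOp k f (.inl p) = f (.inr p) :=
  one_mul _

@[simp]
theorem flipOp_inr (p : ℤ × Fin k) : flipOp k f (.inr p) = f (.inl p) :=
  one_mul _

@[simp]
theorem linkOp_inl (i : ℤ) (j : Fin k) : linkOp k f (.inl (i, j)) = f (.inr (i - 1, j)) :=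
  one_mul _

@[simp]
theorem linkOp_inr (i : ℤ) (j : Fin k) : linkOp k f (.inr (i, j)) = f (.inl (i + 1, j)) :=
  one_mul _

@[simp]
theorem meanOp_inl (i : ℤ) (j : Fin k) :
    meanOp k f (.inl (i, j)) = (k : ℂ)⁻¹ * ∑ l, f (.inl (i, l)) := by
  rw [meanOp, smul_apply, ellTwo_smul_apply, mul_apply_eq_comp, flipOp_inl, sub_apply,
    ellTwo_sub_apply]
  simp [adjZ_inr]

@[simp]
theorem meanOp_inr (i : ℤ) (j : Fin k) :
    meanOp k f (.inr (i, j)) = (k : ℂ)⁻¹ * ∑ l, f (.inr (i, l)) := by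
  rw [meanOp, smul_apply, ellTwo_smul_apply, mul_apply_eq_comp, flipOp_inr, sub_apply,
    ellTwo_sub_apply]
  simp [adjZ_inl]

theorem flipOp_mul_self : flipOp k * flipOp k = 1 := by
  ext f (v | v) <;> simp

theorem linkOp_mul_self : linkOp k * linkOp k = 1 := by
  ext f (⟨i, j⟩ | ⟨i, j⟩) <;> simp

theorem isSelfAdjoint_flipOp : IsSelfAdjoint (flipOp k) :=
  left_inv_eq_right_inv (Unitary.star_mul_self_of_mem (weightedPerm _ _).2) flipOp_mul_self

theorem isSelfAdjoint_linkOp : IsSelfAdjoint (linkOp k) :=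
  left_inv_eq_right_inv (Unitary.star_mul_self_of_mem (weightedPerm _ _).2) linkOp_mul_self

theorem isSelfAdjoint_adjZ : IsSelfAdjoint (adjZ k) :=
  isSelfAdjoint_adjacencyOperator _

theorem commute_flipOp_meanOp : Commute (flipOp k) (meanOp k) := by
  ext f (⟨i, j⟩ | ⟨i, j⟩) <;> simp

theorem commute_linkOp_meanOp : Commute (linkOp k) (meanOp k) := by
  ext f (⟨i, j⟩ | ⟨i, j⟩) <;> simp

theorem isSelfAdjoint_meanOp : IsSelfAdjoint (meanOp k) := by
  have hflip : IsSelfAdjoint (flipOp k * meanOp k) := by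
    rw [meanOp, mul_smul_comm, ← mul_assoc, flipOp_mul_self, one_mul]
    exact .smul (by simp [isSelfAdjoint_iff]) (isSelfAdjoint_adjZ.sub isSelfAdjoint_linkOp)
  have h := isSelfAdjoint_flipOp.commute_iff hflip |>.1 ?_
  · rwa [← mul_assoc, flipOp_mul_self, one_mul] at h
  · exact (Commute.refl _).mul_right commute_flipOp_meanOp

/-- The operator `N` with `G A = 1 + k N`, where `A` is the adjacency operator and `G` is `linkOp`:
it averages over each layer and then translates the functions on `{v_{i,j}}` and on `{w_{i,j}}`
by one layer, in opposite directions. -/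
noncomputable def shiftMeanOp (k : ℕ) : EllTwo (LayerVertex ℤ k) →L[ℂ] EllTwo (LayerVertex ℤ k) :=
  linkOp k * flipOp k * meanOp k

theorem star_shiftMeanOp : star (shiftMeanOp k) = meanOp k * (flipOp k * linkOp k) := by
  rw [shiftMeanOp, star_mul, star_mul, isSelfAdjoint_meanOp.star_eq, isSelfAdjoint_flipOp.star_eq,
    isSelfAdjoint_linkOp.star_eq]

theorem star_mul_self_linkOp_mul_adjZ :
    star (linkOp k * adjZ k) * (linkOp k * adjZ k) = adjZ k ^ 2 := by
  rw [star_mul, isSelfAdjoint_adjZ.star_eq, isSelfAdjoint_linkOp.star_eq, mul_assoc,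
    ← mul_assoc (linkOp k), linkOp_mul_self, one_mul, sq]

section NeZero

variable [NeZero k]

theorem isStarProjection_meanOp : IsStarProjection (meanOp k) where
  isIdempotentElem := by
    ext f (⟨i, j⟩ | ⟨i, j⟩) <;> simp [NeZero.ne k]
  isSelfAdjoint := isSelfAdjoint_meanOp

theorem adjZ_eq : adjZ k = linkOp k + (k : ℂ) • (flipOp k * meanOp k) := by
  ext f (⟨i, j⟩ | ⟨i, j⟩) <;>
    rw [add_apply, smul_apply, ellTwo_add_apply, ellTwo_smul_apply] <;>
    simp [adjZ_inl, adjZ_inr, NeZero.ne k]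

theorem commute_adjZ_meanOp : Commute (adjZ k) (meanOp k) := by
  rw [adjZ_eq]
  exact commute_linkOp_meanOp.add_left
    ((commute_flipOp_meanOp.mul_left (Commute.refl _)).smul_left _)

theorem linkOp_mul_adjZ : linkOp k * adjZ k = 1 + (k : ℂ) • shiftMeanOp k := by
  rw [adjZ_eq, mul_add, linkOp_mul_self, mul_smul_comm, shiftMeanOp, mul_assoc]

theorem star_mul_self_shiftMeanOp : star (shiftMeanOp k) * shiftMeanOp k = meanOp k := by
  calc star (shiftMeanOp k) * shiftMeanOp k
      = meanOp k * (flipOp k * (linkOp k * linkOp k) * flipOp k) * meanOp k := by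
        rw [star_shiftMeanOp, shiftMeanOp]
        simp only [mul_assoc]
    _ = meanOp k := by
        rw [linkOp_mul_self, mul_one, flipOp_mul_self, mul_one,
          isStarProjection_meanOp.isIdempotentElem.eq]

theorem shiftMeanOp_mul_star_self : shiftMeanOp k * star (shiftMeanOp k) = meanOp k := by
  have hcomm : Commute (linkOp k * flipOp k) (meanOp k) :=
    commute_linkOp_meanOp.mul_left commute_flipOp_meanOp
  calc shiftMeanOp k * star (shiftMeanOp k)
      = linkOp k * flipOp k * (meanOp k * meanOp k) * (flipOp k * linkOp k) := by
        rw [star_shiftMeanOp, shiftMeanOp]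
        simp only [mul_assoc]
    _ = meanOp k * (linkOp k * (flipOp k * flipOp k) * linkOp k) := by
        rw [isStarProjection_meanOp.isIdempotentElem.eq, hcomm.eq]
        simp only [mul_assoc]
    _ = meanOp k := by rw [flipOp_mul_self, mul_one, linkOp_mul_self, mul_one]

instance isStarNormal_shiftMeanOp : IsStarNormal (shiftMeanOp k) :=
  ⟨star_mul_self_shiftMeanOp.trans shiftMeanOp_mul_star_self.symm⟩

end NeZero

end LayerOperators

section SpectrumZ

open Metric
open scoped Pointwise

variable {k : ℕ}

/-- The weight `w ^ i` on `v_{i,j}` and `w ^ (-i)` on `w_{i,j}`; multiplication by it conjugates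
`shiftMeanOp k` into `w • shiftMeanOp k`. -/
noncomputable def layerPhase (k : ℕ) (w : Circle) : LayerVertex ℤ k → Circle :=
  Sum.elim (fun p => w ^ p.1) fun p => w ^ (-p.1)

theorem spectrum_smul_shiftMeanOp (w : Circle) :
    spectrum ℂ ((w : ℂ) • shiftMeanOp k) = spectrum ℂ (shiftMeanOp k) := by
  let U : EllTwo (LayerVertex ℤ k) →L[ℂ] EllTwo (LayerVertex ℤ k) :=
    weightedPerm (layerPhase k w) (Equiv.refl _)
  have hU : U ∈ unitary (EllTwo (LayerVertex ℤ k) →L[ℂ] EllTwo (LayerVertex ℤ k)) :=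
    (weightedPerm (layerPhase k w) (Equiv.refl _)).2
  have hcomm : U * shiftMeanOp k = ((w : ℂ) • shiftMeanOp k) * U := by
    ext f (⟨i, j⟩ | ⟨i, j⟩) <;>
      rw [smul_mul_assoc, smul_apply, ellTwo_smul_apply] <;>
      simp [U, layerPhase, shiftMeanOp, ← Finset.mul_sum, zpow_sub₀, zpow_add₀]
    · field_simp
    · field_simp
  have hconj : U * shiftMeanOp k * star U = (w : ℂ) • shiftMeanOp k := by
    rw [hcomm, mul_assoc, Unitary.mul_star_self_of_mem hU, mul_one]
  rw [← hconj]
  exact Unitary.spectrum_star_right_conjugate (U := ⟨U, hU⟩)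

theorem meanOp_single_self (v : LayerVertex ℤ k) : meanOp k (lp.single 2 v 1) v = (k : ℂ)⁻¹ := by
  rcases v with ⟨i, j⟩ | ⟨i, j⟩ <;> simp [Pi.single_apply]

theorem meanOp_ne_zero [NeZero k] : meanOp k ≠ 0 := by
  intro h
  have hv := (meanOp_single_self (k := k) (.inl (0, 0))).symm
  simp [h, NeZero.ne k] at hv

theorem meanOp_ne_one (hk : 2 ≤ k) : meanOp k ≠ 1 := by
  intro h
  have : NeZero k := ⟨by omega⟩
  have hv := meanOp_single_self (k := k) (.inl (0, 0))
  simp [h] at hv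
  omega

theorem spectrum_shiftMeanOp (hk : 2 ≤ k) :
    spectrum ℂ (shiftMeanOp k) = insert 0 (sphere 0 1) := by
  have : NeZero k := ⟨by omega⟩
  refine spectrum_of_isStarNormal_of_rotation ?_ ?_ ?_ fun w hw => ?_
  · rw [star_mul_self_shiftMeanOp]
    exact isStarProjection_meanOp.isIdempotentElem
  · rw [star_mul_self_shiftMeanOp]
    exact meanOp_ne_zero
  · rw [star_mul_self_shiftMeanOp]
    exact meanOp_ne_one hk
  · exact spectrum_smul_shiftMeanOp ⟨w, mem_sphere_zero_iff_norm.2 hw⟩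

theorem norm_image_spectrum_linkOp_mul_adjZ (hk : 2 ≤ k) :
    norm '' spectrum ℂ (linkOp k * adjZ k) = insert 1 (Set.Icc ((k : ℝ) - 1) (k + 1)) := by
  have : NeZero k := ⟨by omega⟩
  have hk' : (2 : ℝ) ≤ k := by exact_mod_cast hk
  have hsphere : (fun z : ℂ => 1 + (k : ℂ) * z) '' sphere 0 1 = sphere 1 (k : ℝ) := by
    have hsmul := smul_sphere' (NeZero.ne (k : ℂ)) (0 : ℂ) 1
    rw [← Set.image_smul, smul_zero, mul_one, Complex.norm_natCast] at hsmul
    rw [← Set.image_image (1 + ·) fun z => (k : ℂ) * z]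
    simp only [smul_eq_mul] at hsmul
    simp [hsmul]
  have hrank : 1 < Module.rank ℝ ℂ := by simp
  rw [linkOp_mul_adjZ, spectrum_one_add_smul (NeZero.ne _), spectrum_shiftMeanOp hk,
    Set.image_insert_eq, hsphere, Set.image_insert_eq, image_norm_sphere hrank 1 k.cast_nonneg,
    mul_zero, add_zero, norm_one, abs_sub_comm, abs_of_nonneg (by linarith), add_comm]

theorem spectrum_adjZ (hk : 2 ≤ k) :
    spectrum ℂ (adjZ k) = (fun t : ℝ => (t : ℂ)) ''
      ({-1, 1} ∪ Set.Icc ((k : ℝ) - 1) (k + 1) ∪ Set.Icc (-(k : ℝ) - 1) (-k + 1)) := by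
  have : NeZero k := ⟨by omega⟩
  have hk' : (2 : ℝ) ≤ k := by exact_mod_cast hk
  have hnormal : IsStarNormal (linkOp k * adjZ k) := by
    rw [linkOp_mul_adjZ]
    infer_instance
  have habs : {t : ℝ | |t| ∈ insert 1 (Set.Icc ((k : ℝ) - 1) (k + 1))} =
      {-1, 1} ∪ Set.Icc ((k : ℝ) - 1) (k + 1) ∪ Set.Icc (-(k : ℝ) - 1) (-k + 1) := by
    ext t
    simp only [Set.mem_ofPred_eq, Set.mem_insert_iff, Set.mem_union, Set.mem_Icc,
      Set.mem_singleton_iff]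
    grind
  rw [← habs, ← norm_image_spectrum_linkOp_mul_adjZ hk]
  exact spectrum_eq_of_neg_of_sq_eq_star_mul_self
    (spectrum_neg_adjacencyOperator _ layerBipartition) star_mul_self_linkOp_mul_adjZ.symm

end SpectrumZ

section EigenvectorsZ

theorem eq_neg_of_norm_add_smul_eq {𝕜 E : Type*} [RCLike 𝕜] [NormedAddCommGroup E]
    [InnerProductSpace 𝕜 E] {z s : E} (hs : ‖s‖ = ‖z‖) {r : ℝ} (hr : 2 ≤ r)
    (h : ‖z + (r : 𝕜) • s‖ = ‖z‖) : s = -z := by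
  have hexpand : ∀ t : ℝ,
      ‖z + (t : 𝕜) • s‖ ^ 2 = ‖z‖ ^ 2 + t * (2 * RCLike.re (inner 𝕜 z s) + t * ‖z‖ ^ 2) := by
    intro t
    rw [norm_add_sq (𝕜 := 𝕜), inner_smul_right, RCLike.re_ofReal_mul, norm_smul, RCLike.norm_ofReal,
      mul_pow, sq_abs, hs]
    ring
  have hinner : r * (2 * RCLike.re (inner 𝕜 z s) + r * ‖z‖ ^ 2) = 0 := by
    have hr := hexpand r
    rw [h] at hr
    linarith
  have hsum : ‖z + s‖ ^ 2 = (2 - r) * ‖z‖ ^ 2 := by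
    have h1 := hexpand 1
    rw [RCLike.ofReal_one, one_smul] at h1
    linarith [(mul_eq_zero.1 hinner).resolve_left (by linarith)]
  have hzs : z + s = 0 := by
    rw [← norm_eq_zero, ← sq_eq_zero_iff]
    exact le_antisymm (hsum.trans_le (by nlinarith [sq_nonneg ‖z‖])) (sq_nonneg _)
  exact eq_neg_of_add_eq_zero_right hzs

variable {k : ℕ}

theorem norm_linkOp_apply (y : EllTwo (LayerVertex ℤ k)) : ‖linkOp k y‖ = ‖y‖ :=
  Unitary.norm_map (weightedPerm 1 (linkPerm k)) y

theorem norm_flipOp_apply (y : EllTwo (LayerVertex ℤ k)) : ‖flipOp k y‖ = ‖y‖ :=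
  Unitary.norm_map (weightedPerm 1 (flipPerm k)) y

theorem iterate_flipPerm_linkPerm_inl (i : ℤ) (j : Fin k) (n : ℕ) :
    (flipPerm k ∘ linkPerm k)^[n] (.inl (i, j)) = .inl (i - n, j) := by
  induction n with
  | zero => simp
  | succ n ih =>
    rw [Function.iterate_succ_apply', ih]
    simp [flipPerm, linkPerm, Function.Involutive.toPerm]
    ring

theorem iterate_flipPerm_linkPerm_inr (i : ℤ) (j : Fin k) (n : ℕ) :
    (flipPerm k ∘ linkPerm k)^[n] (.inr (i, j)) = .inr (i + n, j) := by
  induction n with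
  | zero => simp
  | succ n ih =>
    rw [Function.iterate_succ_apply', ih]
    simp [flipPerm, linkPerm, Function.Involutive.toPerm]
    ring

theorem injective_iterate_flipPerm_linkPerm (v : LayerVertex ℤ k) :
    Function.Injective fun n : ℕ => (flipPerm k ∘ linkPerm k)^[n] v := by
  intro m n h
  rcases v with ⟨i, j⟩ | ⟨i, j⟩
  · simpa [iterate_flipPerm_linkPerm_inl] using h
  · simpa [iterate_flipPerm_linkPerm_inr] using h

theorem eq_zero_of_linkOp_flipOp_eq_neg {z : EllTwo (LayerVertex ℤ k)}
    (hz : linkOp k (flipOp k z) = -z) : z = 0 := by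
  ext v
  refine eq_zero_of_norm_apply_eq (σ := flipPerm k ∘ linkPerm k) (fun u => ?_)
    (injective_iterate_flipPerm_linkPerm v)
  have hu : linkOp k (flipOp k z) u = z (flipPerm k (linkPerm k u)) := by
    simp [linkOp, flipOp]
  rw [Function.comp_apply, ← hu, hz]
  exact norm_neg _

theorem meanOp_apply_eq_zero_of_adjZ_apply_eq (hk : 2 ≤ k) {c : ℂ} (hc : ‖c‖ = 1)
    {y : EllTwo (LayerVertex ℤ k)} (hy : adjZ k y = c • y) : meanOp k y = 0 := by
  have : NeZero k := ⟨by omega⟩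
  set z := meanOp k y
  have hQz : meanOp k z = z := DFunLike.congr_fun isStarProjection_meanOp.isIdempotentElem.eq y
  have hAz : adjZ k z = c • z := by
    rw [← map_smul, ← hy]
    exact DFunLike.congr_fun commute_adjZ_meanOp.eq y
  have hGAz : linkOp k (adjZ k z) = z + (k : ℂ) • linkOp k (flipOp k z) := by
    have h := DFunLike.congr_fun linkOp_mul_adjZ z
    simp only [shiftMeanOp, mul_apply_eq_comp, add_apply, smul_apply, one_apply_eq_self, hQz] at h
    exact h
  refine eq_zero_of_linkOp_flipOp_eq_neg (eq_neg_of_norm_add_smul_eq (𝕜 := ℂ) (r := k) ?_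
    (by exact_mod_cast hk) ?_)
  · rw [norm_linkOp_apply, norm_flipOp_apply]
  · rw [RCLike.ofReal_natCast, ← hGAz, norm_linkOp_apply, hAz, norm_smul, hc, one_mul]

/-- The orthogonal projection onto the eigenspace of the adjacency operator for `c = ±1`. -/
noncomputable def eigenprojection (k : ℕ) (c : ℝ) :
    EllTwo (LayerVertex ℤ k) →L[ℂ] EllTwo (LayerVertex ℤ k) :=
  (2 : ℂ)⁻¹ • ((1 + (c : ℂ) • linkOp k) * (1 - meanOp k))

theorem eigenprojection_apply (c : ℝ) (x : EllTwo (LayerVertex ℤ k)) :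
    eigenprojection k c x =
      (2 : ℂ)⁻¹ • ((x - meanOp k x) + (c : ℂ) • linkOp k (x - meanOp k x)) :=
  rfl

theorem isSelfAdjoint_eigenprojection (c : ℝ) : IsSelfAdjoint (eigenprojection k c) := by
  have hlink : IsSelfAdjoint (1 + (c : ℂ) • linkOp k) :=
    (IsSelfAdjoint.one _).add (.smul (Complex.conj_ofReal c) isSelfAdjoint_linkOp)
  have hmean : IsSelfAdjoint (1 - meanOp k) := (IsSelfAdjoint.one _).sub isSelfAdjoint_meanOp
  have hcomm : Commute (1 + (c : ℂ) • linkOp k) (1 - meanOp k) :=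
    (Commute.one_right _).sub_right
      ((Commute.one_left _).add_left (commute_linkOp_meanOp.smul_left _))
  exact .smul (by simp [isSelfAdjoint_iff]) ((hlink.commute_iff hmean).1 hcomm)

theorem linkOp_mul_eigenprojection {c : ℝ} (hc : c ^ 2 = 1) :
    linkOp k * eigenprojection k c = (c : ℂ) • eigenprojection k c := by
  have hcc : (c : ℂ) * c = 1 := by exact_mod_cast (sq c).symm.trans hc
  have hlink : linkOp k * (1 + (c : ℂ) • linkOp k) = (c : ℂ) • (1 + (c : ℂ) • linkOp k) := by
    rw [mul_add, mul_one, mul_smul_comm, linkOp_mul_self, smul_add, smul_smul, hcc, one_smul,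
      add_comm]
  rw [eigenprojection, mul_smul_comm, ← mul_assoc, hlink, smul_mul_assoc, smul_comm]

theorem meanOp_mul_eigenprojection [NeZero k] (c : ℝ) : meanOp k * eigenprojection k c = 0 := by
  have hcomm : Commute (meanOp k) (1 + (c : ℂ) • linkOp k) :=
    (Commute.one_right _).add_right (commute_linkOp_meanOp.symm.smul_right _)
  rw [eigenprojection, mul_smul_comm, ← mul_assoc, hcomm.eq, mul_assoc,
    isStarProjection_meanOp.isIdempotentElem.mul_one_sub_self, mul_zero, smul_zero]

theorem adjZ_mul_eigenprojection [NeZero k] {c : ℝ} (hc : c ^ 2 = 1) :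
    adjZ k * eigenprojection k c = (c : ℂ) • eigenprojection k c := by
  rw [adjZ_eq, add_mul, smul_mul_assoc, mul_assoc, meanOp_mul_eigenprojection, mul_zero, smul_zero,
    add_zero, linkOp_mul_eigenprojection hc]

theorem eigenprojection_apply_of_adjZ_apply_eq (hk : 2 ≤ k) {c : ℝ} (hc : c ^ 2 = 1)
    {w : EllTwo (LayerVertex ℤ k)} (hw : adjZ k w = (c : ℂ) • w) : eigenprojection k c w = w := by
  have : NeZero k := ⟨by omega⟩
  have hcc : (c : ℂ) * c = 1 := by exact_mod_cast (sq c).symm.trans hc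
  have hmean : meanOp k w = 0 := by
    refine meanOp_apply_eq_zero_of_adjZ_apply_eq hk ?_ hw
    rw [Complex.norm_real, ← pow_eq_one_iff_of_nonneg (norm_nonneg c) two_ne_zero,
      Real.norm_eq_abs, sq_abs, hc]
  have hlink : linkOp k w = (c : ℂ) • w := by
    simpa [adjZ_eq, hmean] using hw
  rw [eigenprojection_apply, hmean, sub_zero, hlink, smul_smul, hcc, one_smul, ← two_smul ℂ w,
    inv_smul_smul₀ two_ne_zero]

theorem starProjection_eigenspace_adjZ (hk : 2 ≤ k) {c : ℝ} (hc : c ^ 2 = 1) :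
    ((adjZ k).eqLocus (algebraMap ℝ (EllTwo (LayerVertex ℤ k) →L[ℂ] EllTwo (LayerVertex ℤ k))
      c)).starProjection = eigenprojection k c := by
  have : NeZero k := ⟨by omega⟩
  ext1 x
  refine Submodule.eq_starProjection_of_mem_of_inner_eq_zero (𝕜 := ℂ) ?_ fun w hw => ?_
  · exact DFunLike.congr_fun (adjZ_mul_eigenprojection hc) x
  · rw [inner_sub_left, ← ContinuousLinearMap.adjoint_inner_right,
      ← ContinuousLinearMap.star_eq_adjoint, (isSelfAdjoint_eigenprojection c).star_eq,
      eigenprojection_apply_of_adjZ_apply_eq hk hc hw, sub_self]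

theorem inner_eigenprojection_single (c : ℝ) (v : LayerVertex ℤ k) :
    inner ℂ (lp.single 2 v 1) (eigenprojection k c (lp.single 2 v 1)) =
      ((1 / 2 - 1 / (2 * k) : ℝ) : ℂ) := by
  have hlink : linkOp k (lp.single 2 v 1) v = 0 := by
    rcases v with ⟨i, j⟩ | ⟨i, j⟩ <;> simp
  have hlinkMean : linkOp k (meanOp k (lp.single 2 v 1)) v = 0 := by
    rcases v with ⟨i, j⟩ | ⟨i, j⟩ <;> simp
  rw [lp.inner_single_left, eigenprojection_apply, map_sub, ellTwo_smul_apply, ellTwo_add_apply,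
    ellTwo_smul_apply, ellTwo_sub_apply, ellTwo_sub_apply, hlink, hlinkMean, meanOp_single_self]
  simp
  ring

theorem spectralMeasureZ_singleton (hk : 2 ≤ k) {c : ℝ} (hc : c ^ 2 = 1) (v : LayerVertex ℤ k) :
    spectralMeasureZ k v {c} = ENNReal.ofReal (1 / 2 - 1 / (2 * k)) := by
  have hnorm := ((adjZ k).eqLocus (algebraMap ℝ (EllTwo (LayerVertex ℤ k) →L[ℂ]
    EllTwo (LayerVertex ℤ k)) c)).re_inner_starProjection_eq_normSq (𝕜 := ℂ) (lp.single 2 v 1)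
  rw [inner_re_symm, starProjection_eigenspace_adjZ hk hc, inner_eigenprojection_single] at hnorm
  exact (spectralMeasure_singleton isSelfAdjoint_adjZ _ c).trans (congrArg _ hnorm.symm)

end EigenvectorsZ

section SpectralMeasureZ

open MeasureTheory

variable {k : ℕ}

instance isProbabilityMeasure_spectralMeasureZ (v : LayerVertex ℤ k) :
    IsProbabilityMeasure (spectralMeasureZ k v) :=
  isProbabilityMeasure_spectralMeasure isSelfAdjoint_adjZ (by simp [lp.norm_single])

theorem map_neg_spectralMeasureZ (v : LayerVertex ℤ k) :
    (spectralMeasureZ k v).map (fun t => -t) = spectralMeasureZ k v :=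
  map_neg_spectralMeasure_adjacencyOperator _ layerBipartition v

theorem ae_mem_spectralMeasureZ (hk : 2 ≤ k) (v : LayerVertex ℤ k) :
    ∀ᵐ t ∂spectralMeasureZ k v,
      t ∈ ({-1, 1} ∪ Set.Icc ((k : ℝ) - 1) (k + 1) ∪ Set.Icc (-(k : ℝ) - 1) (-k + 1) : Set ℝ) := by
  refine (ae_mem_spectrum (adjZ k) (lp.single 2 v 1)).mono fun t ht => ?_
  have hmem : (t : ℂ) ∈ spectrum ℂ (adjZ k) :=
    (spectrum.algebraMap_mem_iff (R := ℝ) ℂ).2 ht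
  rw [spectrum_adjZ hk, Complex.ofReal_injective.mem_set_image] at hmem
  exact hmem

theorem spectralMeasureZ_Ioi_zero (hk : 2 ≤ k) (v : LayerVertex ℤ k) :
    spectralMeasureZ k v (Set.Ioi 0) = ENNReal.ofReal (1 / 2) := by
  refine measure_Ioi_zero_of_map_neg_eq (map_neg_spectralMeasureZ v) ?_
  have hk' : (2 : ℝ) ≤ k := by exact_mod_cast hk
  refine measure_mono_null ?_ (ae_mem_spectralMeasureZ hk v)
  rintro t rfl ht
  simp only [Set.mem_union, Set.mem_insert_iff, Set.mem_singleton_iff, Set.mem_Icc] at ht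
  grind

theorem spectralMeasureZ_Icc_diff_one (hk : 2 ≤ k) (v : LayerVertex ℤ k) :
    spectralMeasureZ k v (Set.Icc ((k : ℝ) - 1) (k + 1) \ {1}) =
      ENNReal.ofReal (1 / (2 * k)) := by
  have hk' : (2 : ℝ) ≤ k := by exact_mod_cast hk
  have hpos : (Set.Icc ((k : ℝ) - 1) (k + 1) \ {1} : Set ℝ) =ᵐ[spectralMeasureZ k v]
      (Set.Ioi 0 \ {1} : Set ℝ) := by
    filter_upwards [ae_mem_spectralMeasureZ hk v] with t ht
    refine propext ?_
    simp only [Set.mem_union, Set.mem_insert_iff, Set.mem_singleton_iff, Set.mem_Icc] at ht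
    change t ∈ Set.Icc ((k : ℝ) - 1) (k + 1) \ {1} ↔ t ∈ Set.Ioi 0 \ {1}
    simp only [Set.mem_sdiff, Set.mem_Icc, Set.mem_singleton_iff, Set.mem_Ioi]
    grind
  have hatom : (0 : ℝ) ≤ 1 / 2 - 1 / (2 * k) := by
    rw [sub_nonneg]
    gcongr
    linarith
  rw [measure_congr hpos, measure_sdiff (by simp) (measurableSet_singleton _).nullMeasurableSet
    (measure_ne_top _ _), spectralMeasureZ_Ioi_zero hk, spectralMeasureZ_singleton hk (one_pow 2),
    ← ENNReal.ofReal_sub _ hatom, sub_sub_cancel]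

theorem spectralMeasureZ_neg (v : LayerVertex ℤ k) (s : Set ℝ) :
    spectralMeasureZ k v (-s) = spectralMeasureZ k v s := by
  conv_rhs => rw [← map_neg_spectralMeasureZ v]
  exact ((MeasurableEquiv.neg ℝ).map_apply s).symm

theorem spectralMeasureZ_Icc_diff_neg_one (hk : 2 ≤ k) (v : LayerVertex ℤ k) :
    spectralMeasureZ k v (Set.Icc (-(k : ℝ) - 1) (-k + 1) \ {-1}) =
      ENNReal.ofReal (1 / (2 * k)) := by
  rw [← spectralMeasureZ_Icc_diff_one hk v, ← spectralMeasureZ_neg]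
  congr 1
  ext t
  simp only [Set.mem_neg, Set.mem_sdiff, Set.mem_Icc, Set.mem_singleton_iff]
  grind

end SpectralMeasureZ

theorem mainTheorem4 (k : ℕ) (hk : 2 ≤ k) :
    -- `Z_k` is an infinite vertex-transitive `(k+1)`-regular graph, the limit of the `W_{n,k}`
    Infinite (LayerVertex ℤ k) ∧
    (graphZ k).IsVertexTransitive ∧
    (graphZ k).IsRegularOfDegree (k + 1) ∧
    SimpleGraph.IsLocalLimit (fun n => graphW n k) (graphZ k) ∧
    -- its spectrum
    IsSelfAdjoint (adjZ k) ∧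
    spectrum ℂ (adjZ k) =
      (fun t : ℝ => (t : ℂ)) ''
        ({-1, 1} ∪ Set.Icc ((k : ℝ) - 1) (k + 1) ∪ Set.Icc (-(k : ℝ) - 1) (-k + 1)) ∧
    -- its spectral measure, at any vertex; for `k = 2` the points `±1` are end points of the
    -- intervals, and their mass is not counted in that of the intervals
    ∀ v : LayerVertex ℤ k,
      spectralMeasureZ k v (Set.Icc ((k : ℝ) - 1) (k + 1) \ {1}) =
        ENNReal.ofReal (1 / (2 * k)) ∧
      spectralMeasureZ k v (Set.Icc (-(k : ℝ) - 1) (-k + 1) \ {-1}) =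
        ENNReal.ofReal (1 / (2 * k)) ∧
      spectralMeasureZ k v {1} = ENNReal.ofReal (1 / 2 - 1 / (2 * k)) ∧
      spectralMeasureZ k v {-1} = ENNReal.ofReal (1 / 2 - 1 / (2 * k)) := by
  have : NeZero k := ⟨by omega⟩
  refine ⟨inferInstance, layerGraph_isVertexTransitive, graphZ_degree k, isLocalLimit_graphW k,
    isSelfAdjoint_adjZ, spectrum_adjZ hk, fun v => ⟨spectralMeasureZ_Icc_diff_one hk v,
    spectralMeasureZ_Icc_diff_neg_one hk v, spectralMeasureZ_singleton hk (by norm_num) v,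
    spectralMeasureZ_singleton hk (by norm_num) v⟩⟩
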